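/- Let $\mathcal I$ (actions of the decision maker), $\mathcal J$ (actions of Nature) and $\mathcal S$ (signals) be finite sets, with $\mathcal I,\mathcal J$ non-empty, of cardinalities $I,J,S$, let $\rho:\mathcal I\times\mathcal J\to\mathbb R$ be a payoff function and $s:\mathcal I\times\mathcal J\to\Delta(\mathcal S)$ a signal function. For $x\in\Delta(\mathcal I)$, $y\in\Delta(\mathcal J)$ put $\rho(x,y)=\sum_{i,j}x_iy_j\rho(i,j)$ and $\mathbf s(y)=\big(\sum_j y_j s(i,j)\big)_{i\in\mathcal I}\in\Delta(\mathcal S)^I$, and let $\mathcal F=\mathbf s(\Delta(\mathcal J))$. Elements of $\Delta(\mathcal S)^I\subset\mathbb R^{I\times S}$ are called flags. For a flag $f$, let $$W(x,f)=\inf\{\rho(x,y):\ y\in\Delta(\mathcal J),\ \mathbf s(y)=\Pi_{\mathcal F}(f)\},$$ where $\Pi_{\mathcal F}$ is the Euclidean projection onto $\mathcal F$, and let $$BR(f)=\Big\{x\in\Delta(\mathcal I):\ W(x,f)=\max_{z\in\Delta(\mathcal I)}W(z,f)\Big\},\qquad B^x=\{f\in\Delta(\mathcal S)^I:\ x\in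 BR(f)\}.$$ A polytope is the convex hull of a finite set of points. A finite family $(K_m)$ of polytopes is a polytopial complex of $K$ if $\bigcup_m K_m=K$, every $K_m$ has non-empty interior, and $K_m\cap K_{m'}$ has empty interior for $m\ne m'$, where interiors are taken relative to the affine subspace generated by $K$. In what follows $K=\Delta(\mathcal S)^I$. **(a) Finite case.** There exist a finite family $\{x(l);\ l\in\mathcal L\}\subset\Delta(\mathcal I)$ and a finite polytopial complex $\{K_m;\ m\in\mathcal M\}$ of $\Delta(\mathcal S)^I$ such that every $K_m$ is contained in some $B^{x(l)}$, every $B^{x(l)}$ contains some $K_m$, and every $B^{x(l)}$ is the union of the cells $K_m$ that it contains and of finitely many polytopes with empty interior. Moreover $BR$ is polytopial constant: there exist a finite polytopial complex $\{K(l);\ l\in\mathcal L'\}$ of $\Delta(\mathcal S)^I$ and points $\{x'(l);\ l\in\mathcal L'\}$ such that $x'(l)\in BR(f)$ for every $l\in\mathcal L'$ and every $f\in K(l)$. **(b) Compact case.** Let instead $\mathbf s$ be a multivalued mapping that assigns to each outcome vector $O\in[-1,1]^I$ a (possibly empty) subset $\mathbf s(O)$ of $\Delta(\mathcal S)^I$,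 and assume that the graph $\{(O,f):\ O\in[-1,1]^I,\ f\in\mathbf s(O)\}$ is a non-empty polytope. Let $\mathcal F=\bigcup_O\mathbf s(O)$ and, for $x\in\Delta(\mathcal I)$ and a flag $f$, $$W(x,f)=\inf\Big\{\sum_{i\in\mathcal I}x_iO_i:\ O\in[-1,1]^I,\ \Pi_{\mathcal F}(f)\in\mathbf s(O)\Big\},$$ with $BR$ and $B^x$ defined from this $W$ as above. Then both conclusions of (a) hold. -/

import Mathlib

namespace PartialMonitoring

noncomputable section

/-! ### Polytopes and polytopial complexes -/

section Complexes

variable {E : Type*} [NormedAddCommGroup E] [NormedSpace ℝ E]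

/-- A polytope: the convex hull of a finite set of points. The empty set is allowed. -/
def IsPolytope {V : Type*} [AddCommGroup V] [Module ℝ V] (P : Set V) : Prop :=
  ∃ t : Set V, t.Finite ∧ P = convexHull ℝ t

/-- The interior of `A`, computed in the affine subspace generated by `K`. It is the ordinary
interior of `A` if `K` has non-empty interior. -/
def interiorIn (K A : Set E) : Set (affineSpan ℝ K) :=
  interior ((fun p : affineSpan ℝ K => (p : E)) ⁻¹' A)

/-- The family `C` is a polytopial complex of `K`: it covers `K` by polytopes with non-empty
interior, any two of which have an intersection with empty interior. All interiors are taken in the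
affine subspace generated by `K`. -/
structure IsPolytopialComplex {ι : Type*} [Finite ι] (K : Set E) (C : ι → Set E) : Prop where
  cover : ⋃ m, C m = K
  isPolytope : ∀ m, IsPolytope (C m)
  interior_nonempty : ∀ m, (interiorIn K (C m)).Nonempty
  interior_inter : ∀ m m', m ≠ m' → interiorIn K (C m ∩ C m') = ∅

/-- The correspondence `B` on `K` is polytopial constant: it has a selection that is constant on
every cell of some finite polytopial complex of `K`. -/
def PolytopialConstant {X : Type*} (K : Set E) (B : E → Set X) : Prop :=
  ∃ (n : ℕ) (C : Fin n → Set E) (x : Fin n → X),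
    IsPolytopialComplex K C ∧ ∀ l, ∀ f ∈ C l, x l ∈ B f

/-- The area `{f ∈ K | x ∈ B f}` of the value `x` of the correspondence `B` on `K`. -/
def area {X : Type*} (K : Set E) (B : E → Set X) (x : X) : Set E :=
  {f | f ∈ K ∧ x ∈ B f}

/-- There are a finite family `x` of values of `B` and a finite polytopial complex `C` of `K` that
subdivides the family of the areas of the `x l`: every cell lies in one of these areas, every one of
these areas contains a cell, and each of them is the union of the cells that it contains and of
finitely many polytopes with empty interior in the affine subspace generated by `K`. -/
def AreasSubdividable {X : Type*} (K : Set E) (B : E → Set X) : Prop :=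
  ∃ (n : ℕ) (x : Fin n → X) (p : ℕ) (C : Fin p → Set E),
    IsPolytopialComplex K C ∧
    (∀ m, ∃ l, C m ⊆ area K B (x l)) ∧
    (∀ l, ∃ m, C m ⊆ area K B (x l)) ∧
    ∀ l, ∃ N : Set (Set E), N.Finite ∧ (∀ P ∈ N, IsPolytope P ∧ interiorIn K P = ∅) ∧
      area K B (x l) = (⋃ m ∈ {m | C m ⊆ area K B (x l)}, C m) ∪ ⋃₀ N

/-- A point of `F` at minimal distance from `p`; for a non-empty closed convex set `F` of a
Euclidean space this is the projection of `p` onto `F`. -/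
def nearestPoint (F : Set E) (p : E) : E :=
  Classical.epsilon fun q => q ∈ F ∧ ∀ r ∈ F, dist p q ≤ dist p r

end Complexes

/-! ### Flags, worst payoffs and best responses

`I` is the set of actions of the decision maker, `J` that of Nature and `S` the set of signals. -/

variable {I J S : Type*} [Fintype I] [Fintype J] [Fintype S]

/-- The Euclidean space `ℝ^(I × S)` in which the flags live. -/
abbrev FlagVector (I S : Type*) := EuclideanSpace ℝ (I × S)

/-- The flag space `Δ(S)^I`. -/
def flagSpace (I S : Type*) [Fintype S] : Set (FlagVector I S) :=
  {f | ∀ i, (fun s => f (i, s)) ∈ stdSimplex ℝ S}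

/-- The payoff `∑ i, x i * O i` of the mixed action `x` against the outcome vector `O`. -/
def outcomePayoff (x O : I → ℝ) : ℝ := ∑ i, x i * O i

/-- The expected payoff `ρ(x, y)`. -/
def payoff (ρ : I → J → ℝ) (x : I → ℝ) (y : J → ℝ) : ℝ :=
  ∑ i, ∑ j, x i * y j * ρ i j

/-- The flag generated by the mixed action `y` of Nature. -/
def signalMap (s : I → J → S → ℝ) (y : J → ℝ) : FlagVector I S :=
  WithLp.toLp 2 fun a => ∑ j, y j * s a.1 j a.2

/-- The set of flags generated by some mixed action of Nature. -/
def realizable (s : I → J → S → ℝ) : Set (FlagVector I S) :=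
  signalMap s '' stdSimplex ℝ J

/-- The worst payoff `W(x, f)` compatible with `x` and `f`, where `f` is first projected onto the
set of realizable flags. -/
def worstPayoff (ρ : I → J → ℝ) (s : I → J → S → ℝ) (x : I → ℝ) (f : FlagVector I S) : ℝ :=
  sInf (payoff ρ x '' {y ∈ stdSimplex ℝ J | signalMap s y = nearestPoint (realizable s) f})

/-- The graph of a signal correspondence `T` from the cube `[-1,1]^I` of outcome vectors to
`ℝ^(I × S)`. -/
def signalGraph (T : Set.Icc (-1 : I → ℝ) 1 → Set (FlagVector I S)) :
    Set ((I → ℝ) × FlagVector I S) :=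
  {a | ∃ O : Set.Icc (-1 : I → ℝ) 1, a.1 = O ∧ a.2 ∈ T O}

/-- The range of a signal correspondence. -/
def compactRealizable (T : Set.Icc (-1 : I → ℝ) 1 → Set (FlagVector I S)) :
    Set (FlagVector I S) :=
  ⋃ O, T O

/-- The worst payoff in the compact case: the infimum of the payoffs of `x` against the outcome
vectors that are compatible with the projection of `f` onto the set of realizable flags. -/
def compactWorstPayoff (T : Set.Icc (-1 : I → ℝ) 1 → Set (FlagVector I S))
    (x : I → ℝ) (f : FlagVector I S) : ℝ :=
  sInf ((fun O : Set.Icc (-1 : I → ℝ) 1 => outcomePayoff x O) ''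
    {O | nearestPoint (compactRealizable T) f ∈ T O})

/-- The mixed actions that maximize `W(·, f)` over the simplex `Δ(I)`. -/
def bestResponse (W : (I → ℝ) → FlagVector I S → ℝ) (f : FlagVector I S) : Set (I → ℝ) :=
  {x | x ∈ stdSimplex ℝ I ∧ ∀ z ∈ stdSimplex ℝ I, W z f ≤ W x f}

end

end PartialMonitoring

/-!
The two cases are instances of one game. Nature's pure action `j` yields an outcome vector `a j` and
a flag `b j`; in the finite case these are the payoffs and the signals of `j`, in the compact case
they are the coordinates of a vertex of the graph. With a mixed action `y`, Nature generates the
flag `∑ j, y j • b j`, which has to be the projection of `f` onto the convex hull of the `b j`.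

By the minimax theorem and linear programming duality, `x` is a best response to `f` if and only if
some `y` that generates the projection of `f` satisfies the following optimality conditions:
* all the pure actions in the support of `x` are best replies to `y`;
* some affine function on the flags lies below the payoffs of `x` against Nature's actions, with
  equality on the support of `y` (`IsTight`);
* `f` minus its projection is a normal vector that is maximal at the `b l` with `l` in the support
  of `y`.

For given supports `I'` of `x` and `J'` of `y`, the second condition involves `x` only, and the two
others describe a bounded polyhedron of pairs `(f, y)`, with `f` in the flag space, whose projection
to the flag space is a polytope (`isPolyhedralUnion_inter_equalizedFlags`). So every area of best responses is a finite
union of polytopes, and one action for each pair of supports is enough to cover the flag space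
(`areasSubdividable_bestResponse`).

What remains is convex geometry. A polytope is a finite union of simplices, by Carathéodory's
theorem, and so a finite union of polyhedra (`IsPolytope.isPolyhedralUnion`). The hyperplanes
bounding all these polyhedra cut the flag space into cells, and each cell either lies in a given
polyhedron or meets it within one of the hyperplanes (`exists_isPolytopialComplex`). This complex
subdivides the areas that contain a cell, and these areas already contain every cell
(`areasSubdividable_of_isPolyhedralUnion`).
-/

namespace PartialMonitoring

open Set Filter Topology

/-! ### Polyhedra and polytopes -/

section Polyhedra

variable {E : Type*} [NormedAddCommGroup E] [NormedSpace ℝ E]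
variable {V : Type*} [NormedAddCommGroup V] [NormedSpace ℝ V]

/-- A polyhedron: the solution set of finitely many weak affine inequalities. -/
def IsPolyhedron (A : Set E) : Prop :=
  ∃ Φ : Set (E →ᵃ[ℝ] ℝ), Φ.Finite ∧ A = {x | ∀ φ ∈ Φ, φ x ≤ 0}

/-- A finite union of polyhedra. -/
def IsPolyhedralUnion (A : Set E) : Prop :=
  ∃ C : Set (Set E), C.Finite ∧ (∀ P ∈ C, IsPolyhedron P) ∧ A = ⋃₀ C

theorem isPolyhedron_nonpos (φ : E →ᵃ[ℝ] ℝ) : IsPolyhedron {x | φ x ≤ 0} :=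
  ⟨{φ}, finite_singleton _, by simp⟩

theorem isPolyhedron_le (φ ψ : E →ᵃ[ℝ] ℝ) : IsPolyhedron {x | φ x ≤ ψ x} := by
  simpa using isPolyhedron_nonpos (φ - ψ)

theorem isPolyhedron_iInter {ι : Type*} [Finite ι] {A : ι → Set E}
    (hA : ∀ i, IsPolyhedron (A i)) : IsPolyhedron (⋂ i, A i) := by
  choose Φ hΦ hAΦ using hA
  refine ⟨⋃ i, Φ i, finite_iUnion hΦ, ?_⟩
  ext x
  simp only [hAΦ, mem_iInter, mem_ofPred_eq, mem_iUnion]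
  grind

theorem isPolyhedron_forall {ι : Type*} [Finite ι] {p : ι → E → Prop}
    (hp : ∀ i, IsPolyhedron {x | p i x}) : IsPolyhedron {x | ∀ i, p i x} := by
  have h := isPolyhedron_iInter hp
  rwa [← ofPred_forall] at h

theorem IsPolyhedron.inter {A B : Set E} (hA : IsPolyhedron A) (hB : IsPolyhedron B) :
    IsPolyhedron (A ∩ B) := by
  rw [inter_eq_iInter]
  exact isPolyhedron_iInter fun b => by cases b <;> assumption

theorem isPolyhedron_eq (φ ψ : E →ᵃ[ℝ] ℝ) : IsPolyhedron {x | φ x = ψ x} := by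
  convert (isPolyhedron_le φ ψ).inter (isPolyhedron_le ψ φ) using 1
  ext x
  simp [le_antisymm_iff]

theorem isPolyhedron_univ : IsPolyhedron (univ : Set E) :=
  ⟨∅, finite_empty, by simp⟩

theorem isPolyhedron_forall_mem {ι : Type*} [Finite ι] {s : Set ι} {p : ι → E → Prop}
    (hp : ∀ i, IsPolyhedron {x | p i x}) : IsPolyhedron {x | ∀ i ∈ s, p i x} := by
  refine isPolyhedron_forall fun i => ?_
  by_cases hi : i ∈ s
  · simpa [hi] using hp i
  · simpa [hi] using isPolyhedron_univ

theorem IsPolyhedron.preimage {A : Set E} (hA : IsPolyhedron A) (L : V →ᵃ[ℝ] E) :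
    IsPolyhedron (L ⁻¹' A) := by
  obtain ⟨Φ, hΦ, rfl⟩ := hA
  refine ⟨(fun φ => φ.comp L) '' Φ, hΦ.image _, ?_⟩
  ext x
  simp

theorem IsPolyhedron.convex {A : Set E} (hA : IsPolyhedron A) : Convex ℝ A := by
  obtain ⟨Φ, -, rfl⟩ := hA
  simp only [ofPred_forall]
  exact convex_iInter fun φ => convex_iInter fun _ => (convex_Iic (0 : ℝ)).affine_preimage φ

theorem isPolyhedralUnion_iUnion {ι : Type*} [Finite ι] {A : ι → Set E}
    (hA : ∀ i, IsPolyhedralUnion (A i)) : IsPolyhedralUnion (⋃ i, A i) := by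
  choose C hPf hP hAP using hA
  refine ⟨⋃ i, C i, finite_iUnion hPf, ?_, ?_⟩
  · intro P hPi
    obtain ⟨i, hi⟩ := mem_iUnion.1 hPi
    exact hP i P hi
  · simp_rw [hAP, sUnion_iUnion]

theorem IsPolytope.image {W W' : Type*} [AddCommGroup W] [Module ℝ W] [AddCommGroup W']
    [Module ℝ W'] {P : Set W} (hP : IsPolytope P) (L : W →ₗ[ℝ] W') : IsPolytope (L '' P) := by
  obtain ⟨t, ht, rfl⟩ := hP
  exact ⟨L '' t, ht.image _, L.image_convexHull t⟩

variable [FiniteDimensional ℝ E]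

theorem IsPolyhedron.isClosed {A : Set E} (hA : IsPolyhedron A) : IsClosed A := by
  obtain ⟨Φ, -, rfl⟩ := hA
  simp only [ofPred_forall]
  exact isClosed_iInter fun φ => isClosed_iInter fun _ =>
    isClosed_le φ.continuous_of_finiteDimensional continuous_const

/-- An extreme point of a polyhedron is determined by the set of its active constraints: if two
points have the same active constraints, the line through them stays inside the polyhedron near each
of them. -/
theorem IsPolyhedron.finite_extremePoints {A : Set E} (hA : IsPolyhedron A) :
    (A.extremePoints ℝ).Finite := by
  obtain ⟨Φ, hΦ, rfl⟩ := hA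
  refine Finite.of_finite_image (f := fun x => {φ ∈ Φ | φ x = 0})
    (hΦ.finite_subsets.subset ?_) ?_
  · rintro _ ⟨x, -, rfl⟩
    exact fun φ hφ => hφ.1
  intro x hx y hy hxy
  by_contra hne
  have hact : ∀ φ ∈ Φ, φ x = 0 → φ y = 0 := fun φ hφ h =>
    ((Set.ext_iff.1 hxy φ).1 ⟨hφ, h⟩).2
  have hev : ∀ᶠ t in 𝓝 (0 : ℝ), ∀ φ ∈ Φ, φ (AffineMap.lineMap x y t) ≤ 0 := by
    rw [hΦ.eventually_all]
    intro φ hφ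
    rcases (hx.1 φ hφ).lt_or_eq with h | h
    · have hc : Continuous fun t : ℝ => φ (AffineMap.lineMap x y t) :=
        φ.continuous_of_finiteDimensional.comp AffineMap.lineMap_continuous
      have h0 : φ (AffineMap.lineMap x y (0 : ℝ)) < 0 := by simpa using h
      exact (hc.continuousAt.eventually_lt continuousAt_const h0).mono fun t ht => ht.le
    · filter_upwards with t
      rw [AffineMap.apply_lineMap, h, hact φ hφ h]
      simp
  have hev' : ∀ᶠ t in 𝓝 (0 : ℝ), ∀ φ ∈ Φ, φ (AffineMap.lineMap x y (-t)) ≤ 0 :=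
    (continuous_neg.tendsto' (0 : ℝ) 0 neg_zero).eventually hev
  obtain ⟨t, ⟨h1, h2⟩, ht⟩ :=
    (((hev.and hev').filter_mono nhdsWithin_le_nhds).and self_mem_nhdsWithin :
      ∀ᶠ t in 𝓝[>] (0 : ℝ), _).exists
  have hseg : x ∈ openSegment ℝ (AffineMap.lineMap x y t) (AffineMap.lineMap x y (-t)) := by
    refine ⟨1 / 2, 1 / 2, by norm_num, by norm_num, by norm_num, ?_⟩
    simp only [AffineMap.lineMap_apply_module']
    module
  have h := hx.2 h1 h2 hseg
  rw [AffineMap.lineMap_apply_module', add_eq_right, smul_eq_zero, sub_eq_zero] at h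
  exact h.elim (ne_of_gt ht) fun h => hne h.symm

theorem IsPolyhedron.isPolytope {A : Set E} (hA : IsPolyhedron A) (hb : Bornology.IsBounded A) :
    IsPolytope A := by
  refine ⟨A.extremePoints ℝ, hA.finite_extremePoints, ?_⟩
  have h := closure_convexHull_extremePoints (Metric.isCompact_of_isClosed_isBounded hA.isClosed hb)
    hA.convex
  rw [(hA.finite_extremePoints.isClosed_convexHull ℝ).closure_eq] at h
  exact h.symm

/-- A simplex is a polyhedron: extend its vertices to an affine basis; the inequalities say that
all barycentric coordinates are non-negative, those of the additional points being zero. -/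
theorem isPolyhedron_convexHull_of_affineIndependent {s : Set E}
    (hs : AffineIndependent ℝ ((↑) : s → E)) : IsPolyhedron (convexHull ℝ s) := by
  obtain ⟨t, hst, hti, htt⟩ := exists_subset_affineIndependent_affineSpan_eq_top hs
  have : Finite t := finite_of_fin_dim_affineIndependent ℝ hti
  have := Fintype.ofFinite t
  let b : AffineBasis t ℝ E := ⟨(↑), hti, by rwa [Subtype.range_coe]⟩
  have hb : ∀ i : t, b i = i := fun _ => rfl
  have key : convexHull ℝ s =
      {x | ∀ i, 0 ≤ b.coord i x} ∩ {x | ∀ i ∈ {i : t | (i : E) ∉ s}, b.coord i x = 0} := by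
    classical
    apply subset_antisymm
    · refine convexHull_min ?_ ?_
      · intro x hx
        have hx' : x = b ⟨x, hst hx⟩ := rfl
        refine ⟨fun i => ?_, fun i hi => ?_⟩
        · rw [hx', b.coord_apply]
          split_ifs <;> norm_num
        · rw [hx', b.coord_apply, if_neg]
          rintro rfl
          exact hi hx
      · simp only [ofPred_forall]
        refine (convex_iInter fun i => (convex_Ici (0 : ℝ)).affine_preimage (b.coord i)).inter ?_
        exact convex_iInter fun i => convex_iInter fun _ =>
          (convex_singleton (0 : ℝ)).affine_preimage (b.coord i)
    · rintro x ⟨h0, h1⟩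
      have hz : ∀ i : t, i ∉ Finset.univ.filter (fun i : t => (i : E) ∈ s) → b.coord i x = 0 := by
        intro i hi
        exact h1 i (by simpa using hi)
      have e1 := b.sum_coord_apply_eq_one x
      have e2 := b.linear_combination_coord_eq_self x
      rw [← Finset.sum_subset (Finset.subset_univ (Finset.univ.filter fun i : t => (i : E) ∈ s))
        fun i _ hi => hz i hi] at e1
      rw [← Finset.sum_subset (Finset.subset_univ (Finset.univ.filter fun i : t => (i : E) ∈ s))
        fun i _ hi => by rw [hz i hi, zero_smul]] at e2
      rw [← e2]
      refine (convex_convexHull ℝ s).sum_mem (fun i _ => h0 i) e1 fun i hi => ?_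
      exact subset_convexHull ℝ s (by simpa [hb] using hi)
  rw [key]
  refine (isPolyhedron_forall fun i => ?_).inter (isPolyhedron_forall_mem fun i => ?_)
  · simpa using isPolyhedron_le (AffineMap.const ℝ E (0 : ℝ)) (b.coord i)
  · exact isPolyhedron_eq (b.coord i) (AffineMap.const ℝ E (0 : ℝ))

/-- By Carathéodory's theorem a polytope is the union of the simplices on its vertices. -/
theorem IsPolytope.isPolyhedralUnion {A : Set E} (hA : IsPolytope A) : IsPolyhedralUnion A := by
  obtain ⟨t, ht, rfl⟩ := hA
  refine ⟨convexHull ℝ '' {s | s ⊆ t ∧ AffineIndependent ℝ ((↑) : s → E)},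
    (ht.finite_subsets.subset fun s hs => hs.1).image _, ?_, ?_⟩
  · rintro _ ⟨s, hs, rfl⟩
    exact isPolyhedron_convexHull_of_affineIndependent hs.2
  · apply subset_antisymm
    · intro x hx
      rw [convexHull_eq_union] at hx
      simp only [mem_iUnion] at hx
      obtain ⟨s, h1, h2, h3⟩ := hx
      exact ⟨_, ⟨s, ⟨h1, h2⟩, rfl⟩, h3⟩
    · rintro x ⟨_, ⟨s, hs, rfl⟩, hx⟩
      exact convexHull_mono hs.1 hx

theorem IsPolyhedron.isPolyhedralUnion_image [FiniteDimensional ℝ V] {A : Set V}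
    (hA : IsPolyhedron A) (hb : Bornology.IsBounded A) (L : V →ₗ[ℝ] E) :
    IsPolyhedralUnion (L '' A) :=
  ((hA.isPolytope hb).image L).isPolyhedralUnion

end Polyhedra

/-! ### Subdivision by a hyperplane arrangement -/

section Subdivision

variable {E : Type*} [NormedAddCommGroup E] [NormedSpace ℝ E]

/-- The points of `K` at which every `φ i` with `i ∈ σ` is non-positive and every other `φ i` is
non-negative: a cell of the hyperplane arrangement `φ i = 0`. -/
def signCell {ι : Type*} (K : Set E) (φ : ι → E →ᵃ[ℝ] ℝ) (σ : Set ι) : Set E :=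
  {x | x ∈ K ∧ (∀ i ∈ σ, φ i x ≤ 0) ∧ ∀ i ∈ σᶜ, 0 ≤ φ i x}

/-- The points of `K` that satisfy strictly all the sign conditions of the cell of `σ`. -/
def strictSignCell {ι : Type*} (K : Set E) (φ : ι → E →ᵃ[ℝ] ℝ) (σ : Set ι) : Set E :=
  {x | x ∈ K ∧ (∀ i ∈ σ, φ i x < 0) ∧ ∀ i ∈ σᶜ, 0 < φ i x}

theorem strictSignCell_subset {ι : Type*} (K : Set E) (φ : ι → E →ᵃ[ℝ] ℝ) (σ : Set ι) :
    strictSignCell K φ σ ⊆ signCell K φ σ :=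
  fun _ hx => ⟨hx.1, fun i hi => (hx.2.1 i hi).le, fun i hi => (hx.2.2 i hi).le⟩

theorem isPolyhedron_signCell {ι : Type*} [Finite ι] {K : Set E} (hK : IsPolyhedron K)
    (φ : ι → E →ᵃ[ℝ] ℝ) (σ : Set ι) : IsPolyhedron (signCell K φ σ) := by
  refine hK.inter ((isPolyhedron_forall_mem fun i => ?_).inter (isPolyhedron_forall_mem fun i => ?_))
  · exact isPolyhedron_nonpos (φ i)
  · exact isPolyhedron_le (AffineMap.const ℝ E (0 : ℝ)) (φ i)

theorem eq_zero_of_mem_affineSpan {K : Set E} {φ : E →ᵃ[ℝ] ℝ} (hφ : ∀ x ∈ K, φ x = 0) {x : E}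
    (hx : x ∈ affineSpan ℝ K) : φ x = 0 := by
  have h : φ x ∈ (affineSpan ℝ K).map φ := AffineSubspace.mem_map_of_mem φ hx
  rw [AffineSubspace.map_span] at h
  have h' := affineSpan_mono ℝ (image_subset_iff.2 hφ : φ '' K ⊆ {0}) h
  simpa using h'

theorem eventually_lineMap_mem {K : Set E} (hK : Convex ℝ K) {x z : E} (hx : x ∈ K) (hz : z ∈ K) :
    ∀ᶠ t in 𝓝[>] (0 : ℝ), AffineMap.lineMap x z t ∈ K := by
  filter_upwards [Ioc_mem_nhdsGT (zero_lt_one (α := ℝ))] with t ht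
  exact hK.lineMap_mem hx hz ⟨ht.1.le, ht.2⟩

theorem AreasSubdividable.polytopialConstant {X : Type*} {K : Set E} {B : E → Set X}
    (h : AreasSubdividable K B) : PolytopialConstant K B := by
  obtain ⟨n, x, p, C, hC, hsub, -⟩ := h
  choose l hl using hsub
  exact ⟨p, C, fun m => x (l m), hC, fun m f hf => (hl m hf).2⟩

/-- A hyperplane that does not contain the affine span of `K` has empty interior in it: from a point
of the hyperplane one leaves it along the segment towards a point `p` outside. -/
theorem interiorIn_eq_empty {K A : Set E} {φ : E →ᵃ[ℝ] ℝ} {p : E} (hp : p ∈ affineSpan ℝ K)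
    (hφp : φ p ≠ 0) (hA : ∀ x ∈ A, φ x = 0) : interiorIn K A = ∅ := by
  rw [interiorIn, eq_empty_iff_forall_notMem]
  intro z hz
  have hz0 : φ z = 0 := hA z (interior_subset (s := (fun p : affineSpan ℝ K => (p : E)) ⁻¹' A) hz)
  let γ : ℝ → affineSpan ℝ K := fun t => ⟨AffineMap.lineMap (z : E) p t,
    AffineMap.lineMap_mem t z.2 hp⟩
  have hγ : Continuous γ := AffineMap.lineMap_continuous.subtype_mk _
  have hγ0 : γ 0 = z := Subtype.ext (by simp [γ])
  have hev : ∀ᶠ t in 𝓝 (0 : ℝ), γ t ∈ interior ((fun p : affineSpan ℝ K => (p : E)) ⁻¹' A) :=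
    hγ.continuousAt.eventually (isOpen_interior.mem_nhds (by rwa [hγ0]))
  obtain ⟨t, ht, ht0⟩ := ((hev.filter_mono nhdsWithin_le_nhds).and self_mem_nhdsWithin :
    ∀ᶠ t in 𝓝[>] (0 : ℝ), _).exists
  have h := hA _ (interior_subset (s := (fun p : affineSpan ℝ K => (p : E)) ⁻¹' A) ht)
  simp only [γ, AffineMap.apply_lineMap, hz0] at h
  rw [AffineMap.lineMap_apply_ring', sub_zero, add_zero, mul_eq_zero] at h
  exact h.elim (ne_of_gt ht0) hφp

variable [FiniteDimensional ℝ E]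

/-- Just after leaving `x` towards `z`, an affine function that does not vanish at `z` has the sign
that it has at `x` or, if it vanishes there, at `z`. -/
theorem eventually_lineMap_neg {φ : E →ᵃ[ℝ] ℝ} {x z : E} (h : φ x < 0 ∨ φ x = 0 ∧ φ z < 0) :
    ∀ᶠ t in 𝓝[>] (0 : ℝ), φ (AffineMap.lineMap x z t) < 0 := by
  rcases h with h | ⟨h, h'⟩
  · have hc : Continuous fun t : ℝ => φ (AffineMap.lineMap x z t) :=
      φ.continuous_of_finiteDimensional.comp AffineMap.lineMap_continuous
    have h0 : φ (AffineMap.lineMap x z (0 : ℝ)) < 0 := by simpa using h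
    exact (hc.continuousAt.eventually_lt continuousAt_const h0).filter_mono nhdsWithin_le_nhds
  · filter_upwards [self_mem_nhdsWithin] with t ht
    rw [AffineMap.apply_lineMap, AffineMap.lineMap_apply_module, h]
    simpa using mul_neg_of_pos_of_neg ht h'

theorem eventually_lineMap_pos {φ : E →ᵃ[ℝ] ℝ} {x z : E} (h : 0 < φ x ∨ φ x = 0 ∧ 0 < φ z) :
    ∀ᶠ t in 𝓝[>] (0 : ℝ), 0 < φ (AffineMap.lineMap x z t) := by
  have := eventually_lineMap_neg (φ := -φ) (x := x) (z := z) (by simpa using h)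
  simpa only [AffineMap.coe_neg, Pi.neg_apply, neg_lt_zero] using this

/-- A convex set is not covered by finitely many hyperplanes none of which contains it. -/
theorem exists_forall_ne_zero {ι : Type*} [Finite ι] {K : Set E} (hK : Convex ℝ K)
    (hne : K.Nonempty) {φ : ι → E →ᵃ[ℝ] ℝ} (hφ : ∀ i, ∃ x ∈ K, φ i x ≠ 0) :
    ∃ z ∈ K, ∀ i, φ i z ≠ 0 := by
  suffices h : ∀ s : Set ι, s.Finite → ∃ z ∈ K, ∀ i ∈ s, φ i z ≠ 0 by
    simpa using h univ finite_univ
  intro s hs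
  induction s, hs using Set.Finite.induction_on with
  | empty => exact hne.imp fun z hz => ⟨hz, by simp⟩
  | @insert j s _ hs ih =>
    obtain ⟨z, hz, hzs⟩ := ih
    obtain ⟨y, hy, hyj⟩ := hφ j
    by_cases hzj : φ j z = 0
    · have hev : ∀ i ∈ insert j s, ∀ᶠ t in 𝓝[>] (0 : ℝ), φ i (AffineMap.lineMap z y t) ≠ 0 := by
        intro i hi
        have hi' : φ i z < 0 ∨ φ i z = 0 ∧ φ i y < 0 ∨ (0 < φ i z ∨ φ i z = 0 ∧ 0 < φ i y) := by
          rcases hi with rfl | hi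
          · rcases hyj.lt_or_gt with h | h <;> simp [hzj, h]
          · rcases (hzs i hi).lt_or_gt with h | h <;> simp [h]
        rcases or_assoc.2 hi' with h | h
        · exact (eventually_lineMap_neg h).mono fun t ht => ht.ne
        · exact (eventually_lineMap_pos h).mono fun t ht => ht.ne'
      obtain ⟨t, h1, h2⟩ := (((hs.insert j).eventually_all.2 hev).and
        (eventually_lineMap_mem hK hz hy)).exists
      exact ⟨_, h2, h1⟩
    · exact ⟨z, hz, fun i hi => hi.elim (fun h => h ▸ hzj) (hzs i)⟩

/-- Given finitely many polyhedra, `K` among them, the arrangement of all the hyperplanes that bound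
them cuts the bounded polyhedron `K` into a polytopial complex. A cell `C m` lies in each of the
polyhedra that contains a suitable point of it, and meets all the others in a set with empty
interior. -/
theorem exists_isPolytopialComplex {K : Set E} (hb : Bornology.IsBounded K) {T : Set (Set E)}
    (hT : T.Finite) (hP : ∀ P ∈ T, IsPolyhedron P) (hKT : K ∈ T) :
    ∃ (p : ℕ) (C : Fin p → Set E), IsPolytopialComplex K C ∧
      ∀ m, ∃ w ∈ C m, ∀ P ∈ T, (w ∈ P → C m ⊆ P) ∧
        (¬ C m ⊆ P → IsPolytope (C m ∩ P) ∧ interiorIn K (C m ∩ P) = ∅) := by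
  have hK : IsPolyhedron K := hP K hKT
  have hP' := hP
  choose! Ψ hΨ hPΨ using hP'
  -- Functions that vanish on `K` are left out: they would make distinct sign patterns give the
  -- same cell.
  let Φ : Set (E →ᵃ[ℝ] ℝ) := {φ | φ ∈ ⋃ P ∈ T, Ψ P ∧ ∃ x ∈ K, φ x ≠ 0}
  have hΦ : Φ.Finite := (hT.biUnion hΨ).subset fun φ hφ => hφ.1
  have : Finite Φ := hΦ
  let φ : Φ → E →ᵃ[ℝ] ℝ := fun i => i
  let M : Type _ := {σ : Set Φ // (strictSignCell K φ σ).Nonempty}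
  obtain ⟨p, ⟨e⟩⟩ := Finite.exists_equiv_fin M
  let C : M → Set E := fun m => signCell K φ m.1
  have hCK : ∀ m, C m ⊆ K := fun m x hx => hx.1
  have hCpoly : ∀ m, IsPolyhedron (C m) := fun m => isPolyhedron_signCell hK φ m.1
  have hzero : ∀ P ∈ T, ∀ ψ ∈ Ψ P, ψ ∉ Φ → ∀ x ∈ affineSpan ℝ K, ψ x = 0 := by
    intro P hPT ψ hψ hψΦ x hx
    refine eq_zero_of_mem_affineSpan (fun y hy => ?_) hx
    by_contra h
    exact hψΦ ⟨mem_biUnion hPT hψ, y, hy, h⟩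
  have hint : ∀ m, (interiorIn K (C m)).Nonempty := by
    rintro ⟨σ, w, hwK, hw1, hw2⟩
    refine ⟨⟨w, subset_affineSpan ℝ K hwK⟩, ?_⟩
    rw [interiorIn, mem_interior_iff_mem_nhds]
    have hc : ∀ i, Continuous fun y : affineSpan ℝ K => φ i y := fun i =>
      (φ i).continuous_of_finiteDimensional.comp continuous_subtype_val
    have h1 : ∀ᶠ y : affineSpan ℝ K in 𝓝 ⟨w, subset_affineSpan ℝ K hwK⟩,
        ∀ i, (i ∈ σ → φ i y < 0) ∧ (i ∈ σᶜ → 0 < φ i y) := by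
      rw [eventually_all]
      intro i
      by_cases hi : i ∈ σ
      · exact ((hc i).continuousAt.eventually_lt continuousAt_const (hw1 i hi)).mono
          fun y hy => ⟨fun _ => hy, fun h => absurd hi h⟩
      · exact (continuousAt_const.eventually_lt (hc i).continuousAt (hw2 i hi)).mono
          fun y hy => ⟨fun h => absurd h hi, fun _ => hy⟩
    filter_upwards [h1] with y hy
    refine ⟨?_, fun i hi => ((hy i).1 hi).le, fun i hi => ((hy i).2 hi).le⟩
    refine (Set.ext_iff.1 (hPΨ K hKT) y).2 ?_
    intro ψ hψ
    by_cases hψΦ : ψ ∈ Φ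
    · by_cases hσ : (⟨ψ, hψΦ⟩ : Φ) ∈ σ
      · exact ((hy _).1 hσ).le
      · have hwψ : ψ w ≤ 0 := by
          rw [hPΨ K hKT] at hwK
          exact hwK ψ hψ
        exact absurd (hw2 _ hσ) (not_lt.2 hwψ)
    · exact (hzero K hKT ψ hψ hψΦ y y.2).le
  have hcover : ⋃ m, C m = K := by
    refine subset_antisymm (iUnion_subset hCK) fun x hx => ?_
    obtain ⟨z, hz, hzφ⟩ := exists_forall_ne_zero hK.convex ⟨x, hx⟩ (φ := φ) fun i => i.2.2
    let σ : Set Φ := {i | φ i x < 0 ∨ φ i x = 0 ∧ φ i z < 0}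
    have hσc : ∀ i ∈ σᶜ, 0 < φ i x ∨ φ i x = 0 ∧ 0 < φ i z := by
      intro i hi
      have h1 : ¬ (φ i x < 0 ∨ φ i x = 0 ∧ φ i z < 0) := hi
      rcases lt_trichotomy (φ i x) 0 with h | h | h
      · exact absurd (Or.inl h) h1
      · rcases (hzφ i).lt_or_gt with h' | h'
        · exact absurd (Or.inr ⟨h, h'⟩) h1
        · exact Or.inr ⟨h, h'⟩
      · exact Or.inl h
    have hev : ∀ᶠ t in 𝓝[>] (0 : ℝ), AffineMap.lineMap x z t ∈ strictSignCell K φ σ := by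
      refine (eventually_lineMap_mem hK.convex hx hz).and (Eventually.and ?_ ?_)
      · exact (toFinite σ).eventually_all.2 fun i hi => eventually_lineMap_neg hi
      · exact (toFinite σᶜ).eventually_all.2 fun i hi => eventually_lineMap_pos (hσc i hi)
    refine mem_iUnion.2 ⟨⟨σ, hev.exists.elim fun t ht => ⟨_, ht⟩⟩, hx,
      fun i hi => ?_, fun i hi => ?_⟩
    · rcases hi with h | h
      exacts [h.le, h.1.le]
    · rcases hσc i hi with h | h
      exacts [h.le, h.1.ge]
  refine ⟨p, C ∘ e.symm, ⟨?_, ?_, ?_, ?_⟩, ?_⟩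
  · rw [← hcover]
    exact e.symm.surjective.iUnion_comp C
  · exact fun m => (hCpoly _).isPolytope (hb.subset (hCK _))
  · exact fun m => hint _
  · intro m m' hmm'
    have hσ : (e.symm m).1 ≠ (e.symm m').1 := fun h => hmm' (e.symm.injective (Subtype.ext h))
    obtain ⟨i, hi⟩ : ∃ i, ¬ (i ∈ (e.symm m).1 ↔ i ∈ (e.symm m').1) := by
      by_contra! h
      exact hσ (Set.ext h)
    obtain ⟨y, hyK, hy⟩ := i.2.2
    refine interiorIn_eq_empty (φ := φ i) (subset_affineSpan ℝ K hyK) hy fun x hx => ?_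
    by_cases h : i ∈ (e.symm m).1
    · exact le_antisymm (hx.1.2.1 i h) (hx.2.2.2 i fun h' => hi ⟨fun _ => h', fun _ => h⟩)
    · refine le_antisymm (hx.2.2.1 i ?_) (hx.1.2.2 i h)
      by_contra h'
      exact hi ⟨fun h1 => absurd h1 h, fun h1 => absurd h1 h'⟩
  · intro m
    obtain ⟨w, hw⟩ := (e.symm m).2
    have key : ∀ P ∈ T, w ∈ P → C (e.symm m) ⊆ P := by
      intro P hPT hwP x hx
      rw [hPΨ P hPT] at hwP ⊢
      intro ψ hψ
      by_cases hψΦ : ψ ∈ Φ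
      · refine hx.2.1 ⟨ψ, hψΦ⟩ ?_
        by_contra h
        exact absurd (hw.2.2 _ h) (not_lt.2 (hwP ψ hψ))
      · exact (hzero P hPT ψ hψ hψΦ x (subset_affineSpan ℝ K hx.1)).le
    refine ⟨w, strictSignCell_subset K φ _ hw, fun P hPT => ⟨key P hPT, fun hnot => ⟨?_, ?_⟩⟩⟩
    · exact ((hCpoly _).inter (hP P hPT)).isPolytope
        ((hb.subset (hCK _)).subset inter_subset_left)
    · have hwP : w ∉ P := fun h => hnot (key P hPT h)
      have hwP' := hwP
      rw [hPΨ P hPT] at hwP'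
      simp only [mem_ofPred_eq, not_forall, not_le] at hwP'
      obtain ⟨ψ, hψ, hψw⟩ := hwP'
      refine interiorIn_eq_empty (φ := ψ) (subset_affineSpan ℝ K hw.1) hψw.ne' fun x hx => ?_
      have hψΦ : ψ ∈ Φ := ⟨mem_biUnion hPT hψ, w, hw.1, hψw.ne'⟩
      refine le_antisymm ?_ (hx.1.2.2 ⟨ψ, hψΦ⟩ fun h => ?_)
      · have := hx.2
        rw [hPΨ P hPT] at this
        exact this ψ hψ
      · exact lt_asymm hψw (hw.2.1 _ h)

/-- Finitely many areas that cover the bounded polyhedron `K` can be subdivided, up to discarding some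
of them, if each is a finite union of polyhedra. The areas kept are those that contain a cell of the
common subdivision. They contain every cell, because a polyhedron that contains the distinguished
point of a cell contains the cell. -/
theorem areasSubdividable_of_isPolyhedralUnion {X L : Type*} [Finite L] {K : Set E}
    (hK : IsPolyhedron K) (hb : Bornology.IsBounded K) {B : E → Set X} (x : L → X)
    (hA : ∀ l, IsPolyhedralUnion (area K B (x l))) (hcov : ∀ f ∈ K, ∃ l, x l ∈ B f) :
    AreasSubdividable K B := by
  choose D hDfin hDpoly hDA using hA
  obtain ⟨p, C, hC, hCD⟩ := exists_isPolytopialComplex hb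
    (T := insert K (⋃ l, D l)) ((finite_iUnion hDfin).insert K)
    (by
      rintro P (rfl | hP)
      · exact hK
      · obtain ⟨l, hl⟩ := mem_iUnion.1 hP
        exact hDpoly l P hl) (mem_insert _ _)
  have hDT : ∀ l, ∀ P ∈ D l, P ∈ insert K (⋃ l, D l) := fun l P hP =>
    mem_insert_of_mem _ (mem_iUnion.2 ⟨l, hP⟩)
  obtain ⟨n, ⟨e⟩⟩ := Finite.exists_equiv_fin {l : L // ∃ m, C m ⊆ area K B (x l)}
  refine ⟨n, fun k => x (e.symm k).1, p, C, hC, ?_, fun k => (e.symm k).2, ?_⟩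
  · intro m
    obtain ⟨w, hw, hwP⟩ := hCD m
    have hwK : w ∈ K := by
      rw [← hC.cover]
      exact mem_iUnion.2 ⟨m, hw⟩
    obtain ⟨l, hl⟩ := hcov w hwK
    have hwA : w ∈ area K B (x l) := ⟨hwK, hl⟩
    rw [hDA] at hwA
    obtain ⟨P, hP, hwP'⟩ := hwA
    have hsub : C m ⊆ area K B (x l) := by
      rw [hDA]
      exact ((hwP P (hDT l P hP)).1 hwP').trans (subset_sUnion_of_mem hP)
    exact ⟨e ⟨l, m, hsub⟩, by simpa using hsub⟩
  · intro k
    set l := (e.symm k).1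
    refine ⟨(fun q : Fin p × Set E => C q.1 ∩ q.2) ''
      {q | q.2 ∈ D l ∧ ¬ C q.1 ⊆ q.2}, Finite.image _ ?_, ?_, ?_⟩
    · exact (finite_univ.prod (hDfin l)).subset fun q hq => ⟨mem_univ _, hq.1⟩
    · rintro _ ⟨⟨m, P⟩, ⟨hP, hnot⟩, rfl⟩
      obtain ⟨w, -, hwP⟩ := hCD m
      exact (hwP P (hDT l P hP)).2 hnot
    · apply subset_antisymm
      · intro f hf
        have hfK := hf.1
        rw [← hC.cover] at hfK
        obtain ⟨m, hm⟩ := mem_iUnion.1 hfK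
        have hfD := hf
        rw [hDA] at hfD
        obtain ⟨P, hP, hfP⟩ := hfD
        by_cases h : C m ⊆ P
        · refine Or.inl (mem_biUnion (x := m) ?_ hm)
          change C m ⊆ area K B (x l)
          rw [hDA]
          exact h.trans (subset_sUnion_of_mem hP)
        · exact Or.inr ⟨_, ⟨(m, P), ⟨hP, h⟩, rfl⟩, hm, hfP⟩
      · refine union_subset (iUnion₂_subset fun m hm => hm) ?_
        rintro f ⟨_, ⟨⟨m, P⟩, ⟨hP, -⟩, rfl⟩, -, hfP⟩
        rw [hDA]
        exact ⟨P, hP, hfP⟩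

end Subdivision

/-! ### Linear programming duality and projections -/

section Duality

/-- **Farkas' lemma**: a linear functional that is non-positive wherever finitely many others are is
a combination of them with non-negative coefficients. -/
theorem exists_nonneg_combination {W ι : Type*} [AddCommGroup W] [Module ℝ W] (s : Finset ι)
    (A : ι → W →ₗ[ℝ] ℝ) (b : W →ₗ[ℝ] ℝ) (h : ∀ w, (∀ i ∈ s, A i w ≤ 0) → b w ≤ 0) :
    ∃ c : ι → ℝ, (∀ i, 0 ≤ c i) ∧ ∀ w, b w = ∑ i ∈ s, c i * A i w := by
  classical
  induction s using Finset.induction_on generalizing A b with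
  | empty =>
    refine ⟨0, by simp, fun w => ?_⟩
    have h1 := h w (by simp)
    have h2 := h (-w) (by simp)
    rw [map_neg] at h2
    simp only [Finset.sum_empty]
    linarith
  | insert k s hk ih =>
    by_cases hs : ∀ w, (∀ i ∈ s, A i w ≤ 0) → b w ≤ 0
    · obtain ⟨c, hc, hbc⟩ := ih A b hs
      refine ⟨fun i => if i = k then 0 else c i, fun i => ?_, fun w => ?_⟩
      · dsimp only
        split_ifs
        exacts [le_rfl, hc i]
      · rw [Finset.sum_insert hk, hbc w]
        simp only [if_true, zero_mul, zero_add]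
        refine Finset.sum_congr rfl fun i hi => ?_
        rw [if_neg (ne_of_mem_of_not_mem hi hk)]
    · push Not at hs
      obtain ⟨u, hu, hbu⟩ := hs
      have hku : 0 < A k u := by
        by_contra hle
        refine absurd (h u fun i hi => ?_) (not_le.2 hbu)
        rcases Finset.mem_insert.1 hi with rfl | hi
        exacts [not_lt.1 hle, hu i hi]
      -- Project all the functionals along `u` onto the kernel of `A k`.
      obtain ⟨c, hc, hbc⟩ := ih (fun i => A i - (A i u / A k u) • A k) (b - (b u / A k u) • A k) (by
        intro w hw
        have h1 := h (w - (A k w / A k u) • u) (by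
          intro i hi
          rcases Finset.mem_insert.1 hi with rfl | hi
          · simp [hku.ne']
          · have := hw i hi
            simp only [LinearMap.sub_apply, LinearMap.smul_apply, smul_eq_mul, map_sub,
              map_smul] at this ⊢
            calc _ = A i w - A i u / A k u * A k w := by ring
              _ ≤ 0 := this)
        simp only [LinearMap.sub_apply, LinearMap.smul_apply, smul_eq_mul, map_sub,
          map_smul] at h1 ⊢
        calc _ = b w - A k w / A k u * b u := by ring
          _ ≤ 0 := h1)
      refine ⟨fun i => if i = k then (b u - ∑ i ∈ s, c i * A i u) / A k u else c i,
        fun i => ?_, fun w => ?_⟩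
      · dsimp only
        split_ifs
        · refine div_nonneg (sub_nonneg.2 (le_trans ?_ hbu.le)) hku.le
          exact Finset.sum_nonpos fun i hi => mul_nonpos_of_nonneg_of_nonpos (hc i) (hu i hi)
        · exact hc i
      · rw [Finset.sum_insert hk]
        dsimp only
        rw [if_pos rfl]
        have h1 := hbc w
        simp only [LinearMap.sub_apply, LinearMap.smul_apply, smul_eq_mul] at h1
        have h2 : ∑ i ∈ s, (if i = k then (b u - ∑ i ∈ s, c i * A i u) / A k u else c i) * A i w
            = ∑ i ∈ s, c i * A i w := Finset.sum_congr rfl fun i hi => by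
          rw [if_neg (ne_of_mem_of_not_mem hi hk)]
        have h3 : ∑ i ∈ s, c i * (A i w - A i u / A k u * A k w) =
            ∑ i ∈ s, c i * A i w - (∑ i ∈ s, c i * A i u) / A k u * A k w := by
          rw [Finset.sum_div, Finset.sum_mul, ← Finset.sum_sub_distrib]
          exact Finset.sum_congr rfl fun i _ => by ring
        rw [h2]
        rw [h3] at h1
        rw [sub_div, sub_mul]
        linarith

/-- Linear programming duality with complementary slackness. If `y` minimizes the cost `c` among the
ways of writing a point as a convex combination of the `b j`, then some affine function lies below
the costs, and agrees with them on the support of `y`. -/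
theorem exists_affineMap_le {E J : Type*} [AddCommGroup E] [Module ℝ E] [Fintype J] (b : J → E)
    (c : J → ℝ) {y : J → ℝ} (hy : y ∈ stdSimplex ℝ J)
    (hmin : ∀ y' ∈ stdSimplex ℝ J, ∑ j, y' j • b j = ∑ j, y j • b j →
      ∑ j, y j * c j ≤ ∑ j, y' j * c j) :
    ∃ h : E →ᵃ[ℝ] ℝ, (∀ j, h (b j) ≤ c j) ∧ ∀ j, y j ≠ 0 → h (b j) = c j := by
  classical
  -- A point `(p, q, r)` of this space with `r > 0` encodes the affine function `r⁻¹ (p + q)`.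
  let W := Module.Dual ℝ E × ℝ × ℝ
  let G : J → W →ₗ[ℝ] ℝ := fun j =>
    (Module.Dual.eval ℝ E (b j)) ∘ₗ LinearMap.fst ℝ _ _ +
      LinearMap.fst ℝ ℝ ℝ ∘ₗ LinearMap.snd ℝ _ _ -
      c j • (LinearMap.snd ℝ ℝ ℝ ∘ₗ LinearMap.snd ℝ _ _)
  have hG : ∀ j (w : W), G j w = w.1 (b j) + w.2.1 - c j * w.2.2 := fun j w => rfl
  let A : J ⊕ J → W →ₗ[ℝ] ℝ := Sum.elim G fun j => if y j = 0 then 0 else -G j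
  by_contra hno
  push Not at hno
  obtain ⟨d, hd, hdw⟩ := exists_nonneg_combination Finset.univ A
    (LinearMap.snd ℝ ℝ ℝ ∘ₗ LinearMap.snd ℝ _ _) (by
    intro w hw
    by_contra hr
    have hr' : 0 < w.2.2 := not_le.1 hr
    have hle : ∀ j, w.1 (b j) + w.2.1 ≤ c j * w.2.2 := fun j => by
      have := hw (Sum.inl j) (Finset.mem_univ _)
      simp only [A, Sum.elim_inl, hG] at this
      linarith
    have hge : ∀ j, y j ≠ 0 → c j * w.2.2 ≤ w.1 (b j) + w.2.1 := fun j hj => by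
      have := hw (Sum.inr j) (Finset.mem_univ _)
      simp only [A, Sum.elim_inr, if_neg hj, LinearMap.neg_apply, hG] at this
      linarith
    let h : E →ᵃ[ℝ] ℝ := (w.2.2⁻¹ • w.1).toAffineMap + AffineMap.const ℝ E (w.2.2⁻¹ * w.2.1)
    have hh : ∀ e, h e = (w.1 e + w.2.1) / w.2.2 := fun e => by
      change w.2.2⁻¹ * w.1 e + w.2.2⁻¹ * w.2.1 = _
      field_simp
    obtain ⟨j, hj, hne⟩ := hno h fun j => by
      rw [hh, div_le_iff₀ hr']
      exact hle j
    refine hne ?_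
    rw [hh, div_eq_iff hr'.ne']
    exact le_antisymm (hle j) (hge j hj))
  let μ : J → ℝ := fun j => d (Sum.inl j) - if y j = 0 then 0 else d (Sum.inr j)
  have hμ : ∀ w : W, w.2.2 = ∑ j, μ j * (w.1 (b j) + w.2.1 - c j * w.2.2) := by
    intro w
    have h1 := hdw w
    rw [Fintype.sum_sum_type, ← Finset.sum_add_distrib] at h1
    refine h1.trans (Finset.sum_congr rfl fun j _ => ?_)
    simp only [A, μ, Sum.elim_inl, Sum.elim_inr]
    split_ifs
    · simp [hG]
    · rw [LinearMap.neg_apply, hG]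
      ring
  have hμb : ∑ j, μ j • b j = 0 := by
    rw [← Module.forall_dual_apply_eq_zero_iff ℝ]
    intro p
    have := hμ (p, 0, 0)
    simpa [map_sum] using this.symm
  have hμ1 : ∑ j, μ j = 0 := by simpa using (hμ (0, 1, 0)).symm
  have hμc : ∑ j, μ j * c j = -1 := by
    have := hμ (0, 0, 1)
    simp at this
    linarith
  -- Moving `y` a little in the direction `μ` is feasible and lowers the cost.
  have hev : ∀ᶠ t in 𝓝[>] (0 : ℝ), ∀ j, 0 ≤ y j + t * μ j := by
    rw [eventually_all]
    intro j
    rcases (hy.1 j).lt_or_eq with hj | hj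
    · have hc : Continuous fun t : ℝ => y j + t * μ j := by fun_prop
      have h0 : 0 < y j + 0 * μ j := by simpa using hj
      exact ((continuousAt_const.eventually_lt hc.continuousAt h0).mono
        fun t ht => ht.le).filter_mono nhdsWithin_le_nhds
    · filter_upwards [self_mem_nhdsWithin] with t ht
      have : 0 ≤ μ j := by
        simp only [μ, ← hj, if_true, sub_zero]
        exact hd _
      rw [← hj, zero_add]
      exact mul_nonneg (le_of_lt ht) this
  obtain ⟨t, ht0, ht⟩ := (hev.and self_mem_nhdsWithin).exists
  have h1 := hmin (fun j => y j + t * μ j)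
    ⟨ht0, by rw [Finset.sum_add_distrib, ← Finset.mul_sum, hμ1, hy.2]; simp⟩ (by
      simp_rw [add_smul, mul_smul]
      rw [Finset.sum_add_distrib, ← Finset.smul_sum, hμb]
      simp)
  have h2 : ∑ j, (y j + t * μ j) * c j = ∑ j, y j * c j + t * ∑ j, μ j * c j := by
    rw [Finset.mul_sum, ← Finset.sum_add_distrib]
    exact Finset.sum_congr rfl fun j _ => by ring
  rw [h2, hμc] at h1
  have : 0 < t := ht
  linarith

/-- The variational characterization of the projection onto a compact convex set. -/
theorem nearestPoint_eq_iff {E : Type*} [NormedAddCommGroup E] [InnerProductSpace ℝ E] {F : Set E}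
    (hF : IsCompact F) (hc : Convex ℝ F) (hne : F.Nonempty) (p q : E) :
    nearestPoint F p = q ↔ q ∈ F ∧ ∀ r ∈ F, inner ℝ (p - q) (r - q) ≤ 0 := by
  have key : ∀ q, (q ∈ F ∧ ∀ r ∈ F, dist p q ≤ dist p r) ↔
      q ∈ F ∧ ∀ r ∈ F, inner ℝ (p - q) (r - q) ≤ 0 := by
    intro q
    refine and_congr_right fun hq => ?_
    have : Nonempty F := ⟨⟨q, hq⟩⟩
    rw [← norm_eq_iInf_iff_real_inner_le_zero hc hq]
    simp_rw [dist_eq_norm]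
    constructor
    · intro h
      exact le_antisymm (le_ciInf fun r => h r r.2)
        (ciInf_le ⟨0, by rintro _ ⟨r, rfl⟩; exact norm_nonneg _⟩ (⟨q, hq⟩ : F))
    · intro h r hr
      rw [h]
      exact ciInf_le ⟨0, by rintro _ ⟨r, rfl⟩; exact norm_nonneg _⟩ (⟨r, hr⟩ : F)
  have hex : ∃ q, q ∈ F ∧ ∀ r ∈ F, dist p q ≤ dist p r := by
    obtain ⟨q, hq, hmin⟩ := hF.exists_isMinOn hne (f := fun r => dist p r) (by fun_prop)
    exact ⟨q, hq, fun r hr => hmin hr⟩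
  have hspec := (key _).1 (Classical.epsilon_spec hex)
  change nearestPoint F p ∈ F ∧ ∀ r ∈ F, inner ℝ (p - nearestPoint F p) (r - nearestPoint F p) ≤ 0
    at hspec
  refine ⟨fun h => h ▸ hspec, fun h => ?_⟩
  set n := nearestPoint F p
  have h1 := hspec.2 q h.1
  have h2 := h.2 n hspec.1
  have h3 : inner ℝ (n - q) (n - q) = inner ℝ (p - q) (n - q) + inner ℝ (p - n) (q - n) := by
    rw [← neg_sub n q, inner_neg_right, ← sub_eq_add_neg, ← inner_sub_left]
    congr 1
    abel
  have h4 : inner ℝ (n - q) (n - q) ≤ 0 := by linarith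
  exact sub_eq_zero.1 ((inner_self_eq_zero (𝕜 := ℝ)).1 (le_antisymm h4 real_inner_self_nonneg))

end Duality

/-! ### Optimality conditions in the game -/

section Game

/-- If the average of numbers bounded by `v` is at least `v`, the numbers of positive weight
equal `v`. -/
theorem eq_of_le_average {ι : Type*} [Fintype ι] {w u : ι → ℝ} {v : ℝ} (hw : w ∈ stdSimplex ℝ ι)
    (hu : ∀ i, u i ≤ v) (h : v ≤ ∑ i, w i * u i) {i : ι} (hi : w i ≠ 0) : u i = v := by
  have h0 : ∀ j ∈ Finset.univ, 0 ≤ w j * (v - u j) := fun j _ =>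
    mul_nonneg (hw.1 j) (sub_nonneg.2 (hu j))
  have h1 : ∑ j, w j * (v - u j) = v - ∑ j, w j * u j := by
    simp_rw [mul_sub]
    rw [Finset.sum_sub_distrib, ← Finset.sum_mul, hw.2, one_mul]
  have h2 : ∑ j, w j * (v - u j) = 0 :=
    le_antisymm (by linarith) (Finset.sum_nonneg h0)
  have h3 := (Finset.sum_eq_zero_iff_of_nonneg h0).1 h2 i (Finset.mem_univ i)
  exact (sub_eq_zero.1 ((mul_eq_zero.1 h3).resolve_left hi)).symm

theorem average_le {ι : Type*} [Fintype ι] {w u : ι → ℝ} {v : ℝ} (hw : w ∈ stdSimplex ℝ ι)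
    (hu : ∀ i, u i ≤ v) : ∑ i, w i * u i ≤ v := by
  calc ∑ i, w i * u i ≤ ∑ i, w i * v :=
        Finset.sum_le_sum fun i _ => mul_le_mul_of_nonneg_left (hu i) (hw.1 i)
    _ = v := by rw [← Finset.sum_mul, hw.2, one_mul]

theorem exists_ne_zero_of_mem_stdSimplex {ι : Type*} [Fintype ι] {w : ι → ℝ}
    (hw : w ∈ stdSimplex ℝ ι) : ∃ i, w i ≠ 0 := by
  by_contra! h
  have := hw.2
  simp [h] at this

variable {I J E : Type*} [Fintype I] [Fintype J]

theorem outcomePayoff_pure [DecidableEq I] (i : I) (O : I → ℝ) :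
    outcomePayoff (Pi.single i 1) O = O i := by
  simp [outcomePayoff, Pi.single_apply]

/-- The payoff as a bilinear form. -/
def outcomePayoffForm (I : Type*) [Fintype I] : (I → ℝ) →ₗ[ℝ] (I → ℝ) →ₗ[ℝ] ℝ :=
  LinearMap.mk₂ ℝ outcomePayoff
    (fun x x' O => by simp [outcomePayoff, add_mul, Finset.sum_add_distrib])
    (fun c x O => by simp [outcomePayoff, Finset.mul_sum, mul_assoc])
    (fun x O O' => by simp [outcomePayoff, mul_add, Finset.sum_add_distrib])
    (fun c x O => by simp [outcomePayoff, Finset.mul_sum, mul_left_comm])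

theorem outcomePayoffForm_apply (x O : I → ℝ) : outcomePayoffForm I x O = outcomePayoff x O := rfl

theorem outcomePayoff_linearCombination (x : I → ℝ) (a : J → I → ℝ) (y : J → ℝ) :
    outcomePayoff x (Fintype.linearCombination ℝ a y) = ∑ j, y j * outcomePayoff x (a j) := by
  simp only [← outcomePayoffForm_apply, Fintype.linearCombination_apply, map_sum, map_smul,
    smul_eq_mul]

/-- The minimax theorem for the payoff, when Nature is restricted to a compact convex set of outcome
vectors. -/
theorem exists_saddle [Nonempty I] {Y : Set (I → ℝ)} (hY : IsCompact Y) (hYc : Convex ℝ Y)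
    (hYne : Y.Nonempty) : ∃ z ∈ stdSimplex ℝ I, ∃ O ∈ Y, ∀ x ∈ stdSimplex ℝ I, ∀ O' ∈ Y,
      outcomePayoff x O ≤ outcomePayoff z O' := by
  classical
  have hc1 : ∀ x, Continuous fun O : I → ℝ => outcomePayoff x O := fun x => by
    unfold outcomePayoff; fun_prop
  have hc2 : ∀ O : I → ℝ, Continuous fun x : I → ℝ => outcomePayoff x O := fun O => by
    unfold outcomePayoff; fun_prop
  obtain ⟨O, hO, z, hz, h⟩ := Sion.exists_isSaddlePointOn
    (X := Y) (Y := stdSimplex ℝ I) (f := fun O x => outcomePayoff x O) hYne hYc hY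
    (fun x _ => (hc1 x).continuousOn.lowerSemicontinuousOn)
    (fun x _ => ((outcomePayoffForm I x).convexOn hYc).quasiconvexOn)
    (convex_stdSimplex ℝ I) ⟨_, single_mem_stdSimplex ℝ (Classical.arbitrary I)⟩
    (isCompact_stdSimplex ℝ I)
    (fun O _ => (hc2 O).continuousOn.upperSemicontinuousOn)
    (fun O _ => (((outcomePayoffForm I).flip O).concaveOn
      (convex_stdSimplex ℝ I)).quasiconcaveOn)
  exact ⟨z, hz, O, hO, fun x hx O' hO' => h O' hO' x hx⟩

/-- The mixed actions `y` of Nature whose flag is `g`, where the action `j` yields `b j`. -/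
def fibre [AddCommGroup E] [Module ℝ E] (b : J → E) (g : E) : Set (J → ℝ) :=
  {y | y ∈ stdSimplex ℝ J ∧ Fintype.linearCombination ℝ b y = g}

/-- The payoff that `x` guarantees if Nature has to generate the flag `g`. Its action `j` yields the
outcome vector `a j` and the flag `b j`. -/
noncomputable def guaranteed [AddCommGroup E] [Module ℝ E] (a : J → I → ℝ) (b : J → E)
    (x : I → ℝ) (g : E) : ℝ :=
  sInf ((fun y => outcomePayoff x (Fintype.linearCombination ℝ a y)) '' fibre b g)

/-- All the flags that Nature can generate with mixed actions. -/
def mixtures [AddCommGroup E] [Module ℝ E] (b : J → E) : Set E :=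
  Fintype.linearCombination ℝ b '' stdSimplex ℝ J

/-- Nature's actions in `J'` are tight for `x`: some affine function of the flag lies below the
payoffs of `x` against Nature's actions, with equality on `J'`. This does not involve the flag that
is actually generated. -/
def IsTight [AddCommGroup E] [Module ℝ E] (a : J → I → ℝ) (b : J → E) (x : I → ℝ) (J' : Set J) :
    Prop :=
  ∃ h : E →ᵃ[ℝ] ℝ, (∀ j, h (b j) ≤ outcomePayoff x (a j)) ∧
    ∀ j ∈ J', h (b j) = outcomePayoff x (a j)

/-- The flags `f` whose projection onto `mixtures b` is generated by a mixed action `y` of Nature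
supported in `J'`, against which all the actions in `I'` are best replies. The last
condition states that `f - ∑ j, y j • b j` is normal to `mixtures b`; it is linear in `(f, y)`. -/
def equalizedFlags [NormedAddCommGroup E] [InnerProductSpace ℝ E] (a : J → I → ℝ) (b : J → E)
    (I' : Set I) (J' : Set J) : Set E :=
  {f | ∃ y ∈ stdSimplex ℝ J, (∀ j ∈ J'ᶜ, y j = 0) ∧
    (∀ k ∈ I', ∀ i, Fintype.linearCombination ℝ a y i ≤ Fintype.linearCombination ℝ a y k) ∧
    ∀ l ∈ J', ∀ k, inner ℝ (b k - b l) (f - Fintype.linearCombination ℝ b y) ≤ 0}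

theorem outcomePayoff_le_of_support {x z O : I → ℝ} (hx : x ∈ stdSimplex ℝ I)
    (hz : z ∈ stdSimplex ℝ I) (h : ∀ k ∈ {i | x i ≠ 0}, ∀ i, O i ≤ O k) :
    outcomePayoff z O ≤ outcomePayoff x O := by
  obtain ⟨k, hk⟩ := exists_ne_zero_of_mem_stdSimplex hx
  have h1 : outcomePayoff x O = O k := by
    have : ∀ i, x i * O i = x i * O k := fun i => by
      by_cases hi : x i = 0
      · simp [hi]
      · rw [le_antisymm (h k hk i) (h i hi k)]
    simp_rw [outcomePayoff, this]
    rw [← Finset.sum_mul, hx.2, one_mul]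
  rw [h1]
  exact average_le hz (h k hk)

section Fibre

variable [NormedAddCommGroup E] [NormedSpace ℝ E] {a : J → I → ℝ} {b : J → E} {g : E}

theorem isCompact_fibre (b : J → E) (g : E) : IsCompact (fibre b g) :=
  (isCompact_stdSimplex ℝ J).inter_right
    (isClosed_singleton.preimage (LinearMap.continuous_of_finiteDimensional
      (Fintype.linearCombination ℝ b)) : IsClosed (Fintype.linearCombination ℝ b ⁻¹' {g}))

theorem convex_fibre (b : J → E) (g : E) : Convex ℝ (fibre b g) :=
  (convex_stdSimplex ℝ J).inter ((convex_singleton g).linear_preimage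
    (Fintype.linearCombination ℝ b))

theorem isCompact_mixtures (b : J → E) : IsCompact (mixtures b) :=
  (isCompact_stdSimplex ℝ J).image (LinearMap.continuous_of_finiteDimensional
      (Fintype.linearCombination ℝ b))

theorem convex_mixtures (b : J → E) : Convex ℝ (mixtures b) :=
  (convex_stdSimplex ℝ J).linear_image (Fintype.linearCombination ℝ b)

theorem mixtures_nonempty [Nonempty J] (b : J → E) : (mixtures b).Nonempty := by
  classical
  exact ⟨_, _, single_mem_stdSimplex ℝ (Classical.arbitrary J), rfl⟩

theorem mem_mixtures (b : J → E) (j : J) : b j ∈ mixtures b := by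
  classical
  exact ⟨_, single_mem_stdSimplex ℝ j, by simp [Fintype.linearCombination_apply_single]⟩

theorem continuous_payoff_linearCombination (a : J → I → ℝ) (x : I → ℝ) :
    Continuous fun y => outcomePayoff x (Fintype.linearCombination ℝ a y) :=
  (outcomePayoffForm I x ∘ₗ Fintype.linearCombination ℝ a).continuous_of_finiteDimensional

theorem guaranteed_le (a : J → I → ℝ) (x : I → ℝ) {y : J → ℝ} (hy : y ∈ fibre b g) :
    guaranteed a b x g ≤ outcomePayoff x (Fintype.linearCombination ℝ a y) :=
  csInf_le ((isCompact_fibre b g).image (continuous_payoff_linearCombination a x)).bddBelow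
    (mem_image_of_mem _ hy)

theorem le_guaranteed {x : I → ℝ} {v : ℝ} (hne : (fibre b g).Nonempty)
    (h : ∀ y ∈ fibre b g, v ≤ outcomePayoff x (Fintype.linearCombination ℝ a y)) :
    v ≤ guaranteed a b x g :=
  le_csInf (hne.image _) (by rintro _ ⟨y, hy, rfl⟩; exact h y hy)

/-- Tightness on the support of `y` certifies that `y` is a worst case for `x`. -/
theorem IsTight.guaranteed_eq {x : I → ℝ} {J' : Set J} (h : IsTight a b x J') {y : J → ℝ}
    (hy : y ∈ fibre b g) (hyJ : ∀ j ∈ J'ᶜ, y j = 0) :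
    guaranteed a b x g = outcomePayoff x (Fintype.linearCombination ℝ a y) := by
  refine le_antisymm (guaranteed_le a x hy) (le_guaranteed ⟨y, hy⟩ fun y' hy' => ?_)
  obtain ⟨h, hle, heq⟩ := h
  have haff : ∀ w ∈ fibre b g, h g = ∑ j, w j * h (b j) := by
    intro w hw
    have e1 : ∀ e, h e = h.linear e + h 0 := fun e => congrFun h.decomp e
    rw [← hw.2, e1, Fintype.linearCombination_apply, map_sum]
    simp_rw [fun j => e1 (b j), mul_add, map_smul, smul_eq_mul]
    rw [Finset.sum_add_distrib, ← Finset.sum_mul, hw.1.2, one_mul]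
  rw [outcomePayoff_linearCombination, outcomePayoff_linearCombination]
  calc ∑ j, y j * outcomePayoff x (a j) = ∑ j, y j * h (b j) := by
        refine Finset.sum_congr rfl fun j _ => ?_
        by_cases hj : j ∈ J'
        · rw [heq j hj]
        · rw [hyJ j hj, zero_mul, zero_mul]
    _ = ∑ j, y' j * h (b j) := by rw [← haff y hy, ← haff y' hy']
    _ ≤ ∑ j, y' j * outcomePayoff x (a j) :=
        Finset.sum_le_sum fun j _ => mul_le_mul_of_nonneg_left (hle j) (hy'.1.1 j)

/-- A saddle point of the game in which Nature has to generate `g`: an action `z` and a worst case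
`y` for it against which no action does better. -/
theorem exists_fibre_saddle [Nonempty I] (a : J → I → ℝ) (hg : g ∈ mixtures b) :
    ∃ z ∈ stdSimplex ℝ I, ∃ y ∈ fibre b g, ∀ x ∈ stdSimplex ℝ I,
      outcomePayoff x (Fintype.linearCombination ℝ a y) ≤ guaranteed a b z g := by
  obtain ⟨y₀, hy₀, hy₀g⟩ := hg
  obtain ⟨z, hz, O, ⟨y, hy, rfl⟩, h⟩ := exists_saddle
    (Y := Fintype.linearCombination ℝ a '' fibre b g)
    ((isCompact_fibre b g).image (LinearMap.continuous_of_finiteDimensional _))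
    ((convex_fibre b g).linear_image _) (Nonempty.image _ ⟨y₀, hy₀, hy₀g⟩)
  exact ⟨z, hz, y, hy, fun x hx => le_guaranteed ⟨y, hy⟩ fun y' hy' =>
    h x hx _ (mem_image_of_mem _ hy')⟩

end Fibre

section Projection

variable [NormedAddCommGroup E] [InnerProductSpace ℝ E] {a : J → I → ℝ} {b : J → E}

theorem nearestPoint_mem_mixtures [Nonempty J] (b : J → E) (f : E) :
    nearestPoint (mixtures b) f ∈ mixtures b :=
  ((nearestPoint_eq_iff (isCompact_mixtures b) (convex_mixtures b) (mixtures_nonempty b) f _).1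
    rfl).1

/-- For `y` supported in `J'`, the conditions on the vertices `b k` and `b l` with `l ∈ J'` imply
that the projection of `f` is the flag generated by `y`. -/
theorem nearestPoint_eq_of_support {f : E} {y : J → ℝ} (hy : y ∈ stdSimplex ℝ J) {J' : Set J}
    (hyJ : ∀ j ∈ J'ᶜ, y j = 0)
    (h : ∀ l ∈ J', ∀ k, inner ℝ (b k - b l) (f - Fintype.linearCombination ℝ b y) ≤ 0) :
    nearestPoint (mixtures b) f = Fintype.linearCombination ℝ b y := by
  set g := Fintype.linearCombination ℝ b y with hgdef
  obtain ⟨j₀, -⟩ := exists_ne_zero_of_mem_stdSimplex hy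
  have : Nonempty J := ⟨j₀⟩
  have hsum : ∀ w ∈ stdSimplex ℝ J, ∀ e : E,
      inner ℝ (Fintype.linearCombination ℝ b w - e) (f - g) =
        ∑ j, w j * inner ℝ (b j - e) (f - g) := by
    intro w hw e
    have h1 : Fintype.linearCombination ℝ b w - e = ∑ j, w j • (b j - e) := by
      simp_rw [smul_sub]
      rw [Finset.sum_sub_distrib, ← Finset.sum_smul, hw.2, one_smul,
        Fintype.linearCombination_apply]
    rw [h1, sum_inner]
    simp_rw [real_inner_smul_left]
  refine (nearestPoint_eq_iff (isCompact_mixtures b) (convex_mixtures b) (mixtures_nonempty b)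
    f g).2 ⟨⟨y, hy, rfl⟩, ?_⟩
  rintro _ ⟨w, hw, rfl⟩
  rw [real_inner_comm, hsum w hw]
  refine average_le hw fun k => ?_
  have h2 : inner ℝ (g - b k) (f - g) = ∑ j, y j * inner ℝ (b j - b k) (f - g) := hsum y hy (b k)
  have h3 : 0 ≤ inner ℝ (g - b k) (f - g) := by
    rw [h2]
    refine Finset.sum_nonneg fun l _ => ?_
    by_cases hl : l ∈ J'
    · refine mul_nonneg (hy.1 l) ?_
      have := h l hl k
      rw [← neg_sub, inner_neg_left]
      linarith
    · rw [hyJ l hl, zero_mul]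
  rw [← neg_sub, inner_neg_left]
  linarith

/-- The actions on the support of `y` generate flags in the face of `mixtures b` on which the normal
vector `f - ∑ j, y j • b j` is maximal. -/
theorem inner_le_of_nearestPoint_eq {f : E} {y : J → ℝ}
    (hy : y ∈ fibre b (nearestPoint (mixtures b) f)) {l : J} (hl : y l ≠ 0) (k : J) :
    inner ℝ (b k - b l) (f - Fintype.linearCombination ℝ b y) ≤ 0 := by
  have : Nonempty J := ⟨l⟩
  have h := ((nearestPoint_eq_iff (isCompact_mixtures b) (convex_mixtures b) (mixtures_nonempty b)
    f _).1 hy.2.symm).2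
  set g := Fintype.linearCombination ℝ b y with hgdef
  have h0 : ∀ j, inner ℝ (f - g) (b j - g) ≤ 0 := fun j => h _ (mem_mixtures b j)
  have h1 : ∑ j, y j * inner ℝ (f - g) (b j - g) = 0 := by
    simp_rw [← real_inner_smul_right]
    rw [← inner_sum]
    simp_rw [smul_sub]
    rw [Finset.sum_sub_distrib, ← Finset.sum_smul, hy.1.2, one_smul, hgdef,
      Fintype.linearCombination_apply, sub_self, inner_zero_right]
  have h2 : inner ℝ (f - g) (b l - g) = 0 := eq_of_le_average hy.1 h0 h1.ge hl
  have h3 : b k - b l = (b k - g) - (b l - g) := by abel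
  rw [real_inner_comm, h3, inner_sub_right, h2, sub_zero]
  exact h0 k

/-- Sufficiency of the optimality conditions. -/
theorem guaranteed_le_of_isTight {x z : I → ℝ} (hx : x ∈ stdSimplex ℝ I) (hz : z ∈ stdSimplex ℝ I)
    {J' : Set J} (ht : IsTight a b x J') {f : E}
    (hf : f ∈ equalizedFlags a b {i | x i ≠ 0} J') :
    guaranteed a b z (nearestPoint (mixtures b) f) ≤
      guaranteed a b x (nearestPoint (mixtures b) f) := by
  obtain ⟨y, hy, hyJ, hO, hn⟩ := hf
  have hyf : y ∈ fibre b (nearestPoint (mixtures b) f) :=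
    ⟨hy, (nearestPoint_eq_of_support hy hyJ hn).symm⟩
  rw [ht.guaranteed_eq hyf hyJ]
  exact (guaranteed_le a z hyf).trans (outcomePayoff_le_of_support hx hz hO)

/-- Necessity of the optimality conditions, with `J'` the support of Nature's action in a saddle
point. -/
theorem exists_isTight [Nonempty I] [Nonempty J] {x : I → ℝ} (hx : x ∈ stdSimplex ℝ I) {f : E}
    (h : ∀ z ∈ stdSimplex ℝ I, guaranteed a b z (nearestPoint (mixtures b) f) ≤
      guaranteed a b x (nearestPoint (mixtures b) f)) :
    ∃ J' : Set J, IsTight a b x J' ∧ f ∈ equalizedFlags a b {i | x i ≠ 0} J' := by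
  classical
  obtain ⟨z, hz, y, hy, hzy⟩ := exists_fibre_saddle a (nearestPoint_mem_mixtures b f)
  set g := nearestPoint (mixtures b) f with hg
  have hxy : guaranteed a b x g = outcomePayoff x (Fintype.linearCombination ℝ a y) :=
    le_antisymm (guaranteed_le a x hy) ((hzy x hx).trans (h z hz))
  have hpure : ∀ i, Fintype.linearCombination ℝ a y i ≤
      outcomePayoff x (Fintype.linearCombination ℝ a y) := by
    intro i
    rw [← hxy, ← outcomePayoff_pure i (Fintype.linearCombination ℝ a y)]
    exact (hzy _ (single_mem_stdSimplex ℝ i)).trans (h z hz)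
  obtain ⟨p, hp1, hp2⟩ := exists_affineMap_le b (fun j => outcomePayoff x (a j)) hy.1 (by
    intro y' hy' hyy'
    rw [← outcomePayoff_linearCombination, ← outcomePayoff_linearCombination, ← hxy]
    refine guaranteed_le a x ⟨hy', ?_⟩
    rw [← hy.2, Fintype.linearCombination_apply, Fintype.linearCombination_apply, hyy'])
  refine ⟨{j | y j ≠ 0}, ⟨p, hp1, hp2⟩, y, hy.1, fun j hj => not_not.1 hj, fun k hk i => ?_,
    fun l hl k => inner_le_of_nearestPoint_eq hy hl k⟩
  rw [eq_of_le_average hx hpure le_rfl hk]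
  exact hpure i

theorem exists_maximizer [Nonempty I] [Nonempty J] (a : J → I → ℝ) (b : J → E) (f : E) :
    ∃ x ∈ stdSimplex ℝ I, ∀ z ∈ stdSimplex ℝ I,
      guaranteed a b z (nearestPoint (mixtures b) f) ≤
        guaranteed a b x (nearestPoint (mixtures b) f) := by
  obtain ⟨x, hx, y, hy, h⟩ := exists_fibre_saddle a (nearestPoint_mem_mixtures b f)
  exact ⟨x, hx, fun z hz => (guaranteed_le a z hy).trans (h z hz)⟩

theorem isPolyhedron_stdSimplex (J : Type*) [Fintype J] : IsPolyhedron (stdSimplex ℝ J) := by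
  have h1 : IsPolyhedron {y : J → ℝ | ∀ j, 0 ≤ y j} := isPolyhedron_forall fun j =>
    isPolyhedron_le (AffineMap.const ℝ _ (0 : ℝ))
      (LinearMap.proj (R := ℝ) (φ := fun _ : J => ℝ) j).toAffineMap
  have h2 : IsPolyhedron {y : J → ℝ | ∑ j, y j = 1} := by
    simpa using isPolyhedron_eq
      (∑ j, LinearMap.proj (R := ℝ) (φ := fun _ : J => ℝ) j).toAffineMap
      (AffineMap.const ℝ (J → ℝ) (1 : ℝ))
  exact h1.inter h2

/-- The set of pairs `(f, y)` in the definition of `equalizedFlags` is a bounded polyhedron. -/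
theorem isPolyhedralUnion_inter_equalizedFlags [FiniteDimensional ℝ E] {K : Set E}
    (hK : IsPolyhedron K) (hb : Bornology.IsBounded K) (a : J → I → ℝ) (b : J → E) (I' : Set I)
    (J' : Set J) : IsPolyhedralUnion (K ∩ equalizedFlags a b I' J') := by
  let F : E × (J → ℝ) →ₗ[ℝ] E := LinearMap.fst ℝ _ _
  let Y : E × (J → ℝ) →ₗ[ℝ] J → ℝ := LinearMap.snd ℝ _ _
  let O : E × (J → ℝ) →ₗ[ℝ] I → ℝ := Fintype.linearCombination ℝ a ∘ₗ Y
  let D : E × (J → ℝ) →ₗ[ℝ] E := F - Fintype.linearCombination ℝ b ∘ₗ Y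
  let Q : Set (E × (J → ℝ)) := (F.toAffineMap ⁻¹' K ∩ Y.toAffineMap ⁻¹' stdSimplex ℝ J) ∩
    ({w | ∀ j ∈ J'ᶜ, Y w j = 0} ∩ ({w | ∀ k ∈ I', ∀ i, O w i ≤ O w k} ∩
      {w | ∀ l ∈ J', ∀ k, inner ℝ (b k - b l) (D w) ≤ 0}))
  have hQ : IsPolyhedron Q := by
    refine ((hK.preimage _).inter ((isPolyhedron_stdSimplex J).preimage _)).inter
      (IsPolyhedron.inter ?_ (IsPolyhedron.inter ?_ ?_))
    · exact isPolyhedron_forall_mem fun j => isPolyhedron_eq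
        (LinearMap.proj (R := ℝ) j ∘ₗ Y).toAffineMap (AffineMap.const ℝ _ (0 : ℝ))
    · exact isPolyhedron_forall_mem fun k => isPolyhedron_forall fun i => isPolyhedron_le
        (LinearMap.proj (R := ℝ) i ∘ₗ O).toAffineMap (LinearMap.proj (R := ℝ) k ∘ₗ O).toAffineMap
    · exact isPolyhedron_forall_mem fun l => isPolyhedron_forall fun k =>
        isPolyhedron_nonpos ((innerₛₗ ℝ (b k - b l)) ∘ₗ D).toAffineMap
  have hQb : Bornology.IsBounded Q :=
    (hb.prod (isCompact_stdSimplex ℝ J).isBounded).subset fun w hw => hw.1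
  have hKQ : K ∩ equalizedFlags a b I' J' = F '' Q := by
    apply subset_antisymm
    · rintro f ⟨hf, y, hy, h1, h2, h3⟩
      exact ⟨(f, y), ⟨⟨hf, hy⟩, h1, h2, h3⟩, rfl⟩
    · rintro _ ⟨w, ⟨⟨hf, hy⟩, h1, h2, h3⟩, rfl⟩
      exact ⟨hf, w.2, hy, h1, h2, h3⟩
  rw [hKQ]
  exact hQ.isPolyhedralUnion_image hQb F

end Projection

/-- The game-theoretic core. By linear programming duality `x` is a best response to `f` if and only
if some `J'` is tight for `x` and `f` is equalized by the support of `x` and `J'`. The first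
condition does not involve `f` and the second one involves only the support of `x`. Hence one action
for each pair of supports suffices. -/
theorem areasSubdividable_bestResponse {S : Type*} [Fintype S] [Nonempty I] [Nonempty J]
    {K : Set (FlagVector I S)} (hK : IsPolyhedron K) (hb : Bornology.IsBounded K) (a : J → I → ℝ)
    (b : J → FlagVector I S) {W : (I → ℝ) → FlagVector I S → ℝ}
    (hW : ∀ x f, W x f = guaranteed a b x (nearestPoint (mixtures b) f)) :
    AreasSubdividable K (bestResponse W) := by
  let L : Type _ := {q : Set I × Set J // ∃ x ∈ stdSimplex ℝ I, {i | x i ≠ 0} = q.1 ∧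
    IsTight a b x q.2}
  choose x hx hxI hxJ using fun q : L => q.2
  have harea : ∀ q : L, area K (bestResponse W) (x q) =
      ⋃ J' : {J' : Set J // IsTight a b (x q) J'},
        K ∩ equalizedFlags a b {i | x q i ≠ 0} J' := by
    intro q
    ext f
    simp only [area, bestResponse, hW, mem_ofPred_eq, mem_iUnion, mem_inter_iff]
    constructor
    · rintro ⟨hf, -, h⟩
      obtain ⟨J', h1, h2⟩ := exists_isTight (hx q) h
      exact ⟨⟨J', h1⟩, hf, h2⟩
    · rintro ⟨⟨J', h1⟩, hf, h2⟩
      exact ⟨hf, hx q, fun z hz => guaranteed_le_of_isTight (hx q) hz h1 h2⟩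
  refine areasSubdividable_of_isPolyhedralUnion hK hb x (fun q => ?_) fun f _ => ?_
  · rw [harea]
    exact isPolyhedralUnion_iUnion fun J' => isPolyhedralUnion_inter_equalizedFlags hK hb a b _ _
  · obtain ⟨z, hz, hmax⟩ := exists_maximizer a b f
    obtain ⟨J', h1, h2⟩ := exists_isTight hz hmax
    let q : L := ⟨({i | z i ≠ 0}, J'), z, hz, rfl, h1⟩
    refine ⟨q, hx q, fun z' hz' => ?_⟩
    rw [hW, hW]
    refine guaranteed_le_of_isTight (hx q) hz' (hxJ q) ?_
    rwa [hxI q]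

end Game

/-! ### The flag space -/

section Flags

variable {I J S : Type*} [Fintype I] [Fintype J] [Fintype S]

theorem isPolyhedron_flagSpace (I S : Type*) [Fintype I] [Fintype S] :
    IsPolyhedron (flagSpace I S) := by
  refine isPolyhedron_forall fun i => ?_
  exact (isPolyhedron_stdSimplex S).preimage (LinearMap.pi fun s =>
    (EuclideanSpace.proj (i, s) : FlagVector I S →L[ℝ] ℝ).toLinearMap).toAffineMap

theorem isBounded_flagSpace (I S : Type*) [Fintype I] [Fintype S] :
    Bornology.IsBounded (flagSpace I S) := by
  have h := (PiLp.antilipschitzWith_ofLp 2 fun _ : I × S => ℝ).isBounded_preimage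
    (Metric.isBounded_Icc (0 : I × S → ℝ) 1)
  refine h.subset fun f hf => ⟨fun q => (hf q.1).1 q.2, fun q => ?_⟩
  exact (mem_Icc_of_mem_stdSimplex (hf q.1) q.2).2

theorem areasSubdividable_worstPayoff [Nonempty I] [Nonempty J] (ρ : I → J → ℝ)
    (s : I → J → S → ℝ) : AreasSubdividable (flagSpace I S) (bestResponse (worstPayoff ρ s)) := by
  let b : J → FlagVector I S := fun j => WithLp.toLp 2 fun q => s q.1 j q.2
  have hs : signalMap s = Fintype.linearCombination ℝ b := by
    ext y q
    simp [signalMap, Fintype.linearCombination_apply, b]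
  refine areasSubdividable_bestResponse (isPolyhedron_flagSpace I S) (isBounded_flagSpace I S)
    (fun j i => ρ i j) b fun x f => ?_
  have hpay : payoff ρ x =
      fun y => outcomePayoff x (Fintype.linearCombination ℝ (fun j i => ρ i j) y) := by
    ext y
    simp [payoff, outcomePayoff, Fintype.linearCombination_apply, Finset.mul_sum, mul_assoc]
  rw [worstPayoff, realizable, hs, hpay]
  rfl

theorem areasSubdividable_compactWorstPayoff [Nonempty I]
    (T : Set.Icc (-1 : I → ℝ) 1 → Set (FlagVector I S)) (hne : (signalGraph T).Nonempty)
    (hT : IsPolytope (signalGraph T)) :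
    AreasSubdividable (flagSpace I S) (bestResponse (compactWorstPayoff T)) := by
  obtain ⟨t, ht, hgraph⟩ := hT
  let _ := ht.fintype
  have : Nonempty t := by
    rw [hgraph, convexHull_nonempty_iff] at hne
    exact hne.to_subtype
  let a : t → I → ℝ := fun j => j.1.1
  let b : t → FlagVector I S := fun j => j.1.2
  have hmem : ∀ w, w ∈ signalGraph T ↔ ∃ y ∈ stdSimplex ℝ t,
      (Fintype.linearCombination ℝ a y, Fintype.linearCombination ℝ b y) = w := by
    have hfun : ∀ y : t → ℝ, (∑ x : t, (LinearMap.proj (R := ℝ) x).smulRight x.1) y =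
        (Fintype.linearCombination ℝ a y, Fintype.linearCombination ℝ b y) := by
      intro y
      ext <;> simp [Fintype.linearCombination_apply, a, b, Prod.fst_sum, Prod.snd_sum]
    intro w
    rw [hgraph, ht.convexHull_eq_image]
    refine exists_congr fun y => and_congr_right fun _ => ?_
    rw [← hfun]
  have hreal : compactRealizable T = mixtures b := by
    ext g
    simp only [compactRealizable, mem_iUnion]
    constructor
    · rintro ⟨O, hO⟩
      obtain ⟨y, hy, h⟩ := (hmem (O, g)).1 ⟨O, rfl, hO⟩
      exact ⟨y, hy, congrArg Prod.snd h⟩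
    · rintro ⟨y, hy, rfl⟩
      obtain ⟨O, -, hO⟩ := (hmem _).2 ⟨y, hy, rfl⟩
      exact ⟨O, hO⟩
  refine areasSubdividable_bestResponse (isPolyhedron_flagSpace I S) (isBounded_flagSpace I S)
    a b fun x f => ?_
  rw [compactWorstPayoff, hreal, guaranteed]
  congr 1
  apply subset_antisymm
  · rintro _ ⟨O, hO, rfl⟩
    obtain ⟨y, hy, h⟩ := (hmem (O, _)).1 ⟨O, rfl, hO⟩
    refine ⟨y, ⟨hy, congrArg Prod.snd h⟩, ?_⟩
    exact congrArg (fun w : (I → ℝ) × FlagVector I S => outcomePayoff x w.1) h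
  · rintro _ ⟨y, ⟨hy, hyg⟩, rfl⟩
    obtain ⟨O, h1, h2⟩ := (hmem _).2 ⟨y, hy, rfl⟩
    refine ⟨O, ?_, ?_⟩
    · change nearestPoint (mixtures b) f ∈ T O
      rw [← hyg]
      exact h2
    · exact congrArg (outcomePayoff x) h1.symm

end Flags

end PartialMonitoring

theorem proposition2p2 {I S : Type*} [Fintype I] [Nonempty I] [Fintype S] :
    (∀ (J : Type*) [Fintype J] [Nonempty J] (ρ : I → J → ℝ) (s : I → J → S → ℝ),
      (∀ i j, s i j ∈ stdSimplex ℝ S) →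
        PartialMonitoring.AreasSubdividable (PartialMonitoring.flagSpace I S)
          (PartialMonitoring.bestResponse (PartialMonitoring.worstPayoff ρ s)) ∧
        PartialMonitoring.PolytopialConstant (PartialMonitoring.flagSpace I S)
          (PartialMonitoring.bestResponse (PartialMonitoring.worstPayoff ρ s))) ∧
    (∀ T : Set.Icc (-1 : I → ℝ) 1 → Set (PartialMonitoring.FlagVector I S),
      (∀ O, T O ⊆ PartialMonitoring.flagSpace I S) →
      (PartialMonitoring.signalGraph T).Nonempty →
      PartialMonitoring.IsPolytope (PartialMonitoring.signalGraph T) →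
        PartialMonitoring.AreasSubdividable (PartialMonitoring.flagSpace I S)
          (PartialMonitoring.bestResponse (PartialMonitoring.compactWorstPayoff T)) ∧
        PartialMonitoring.PolytopialConstant (PartialMonitoring.flagSpace I S)
          (PartialMonitoring.bestResponse (PartialMonitoring.compactWorstPayoff T))) := by
  refine ⟨fun J _ _ ρ s _ => ?_, fun T _ hne hT => ?_⟩
  · have h := PartialMonitoring.areasSubdividable_worstPayoff ρ s
    exact ⟨h, h.polytopialConstant⟩
  · have h := PartialMonitoring.areasSubdividable_compactWorstPayoff T hne hT
    exact ⟨h, h.polytopialConstant⟩
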